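/- Let $\mathcal{O}$ be a noetherian integral domain of Krull dimension one with field of fractions $K$, and assume that its normalization $\tilde{\mathcal{O}}$ (the integral closure of $\mathcal{O}$ in $K$) is a finitely generated $\mathcal{O}$-module. For a one-dimensional noetherian domain $R$ with field of fractions $L$, let $\mathrm{Div}(R)$ be the free abelian group on the maximal ideals of $R$. For a maximal ideal $\mathfrak{p}$ of $R$ let $\mathrm{ord}_{\mathfrak{p}}\colon L^*\to\mathbb{Z}$ be the homomorphism $\mathrm{ord}_{\mathfrak{p}}(a/b)=\mathrm{length}_{R_{\mathfrak p}}(R_{\mathfrak{p}}/aR_{\mathfrak{p}})-\mathrm{length}_{R_{\mathfrak p}}(R_{\mathfrak{p}}/bR_{\mathfrak{p}})$ for nonzero $a,b\in R$, let $\mathrm{div}_R(x)=\sum_{\mathfrak{p}}\mathrm{ord}_{\mathfrak{p}}(x)\,\mathfrak{p}$ for $x \in L^*$, and let $\mathrm{Chow}(R)=\mathrm{Div}(R)/\mathrm{div}_R(L^*)$. Let $$f_*\colon \mathrm{Div}(\tilde{\mathcal{O}})\to\mathrm{Div}(\mathcal{O}),\qquad \mathfrak{P}\mapsto[\tilde{\mathcal{O}}/\mathfrak{P}:\mathcal{O}/(\mathfrak{P}\cap\mathcal{O})]\,(\mathfrak{P}\cap\mathcal{O})$$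 be the push-forward of divisors. For a fractional ideal $\mathfrak{A}=\prod\mathfrak{P}^{e_{\mathfrak{P}}}$ of the Dedekind domain $\tilde{\mathcal{O}}$ put $\mathrm{div}_{\tilde{\mathcal{O}}}(\mathfrak{A})=\sum e_{\mathfrak{P}}\mathfrak{P}$, and let $\mathrm{Cl}(\tilde{\mathcal{O}})$ be the ideal class group. A maximal ideal of $\mathcal{O}$ is called invertible if it is invertible as a fractional ideal. For a non-invertible maximal ideal $\mathfrak{p}$ of $\mathcal{O}$ let $g_{\mathfrak{p}}$ be the greatest common divisor of the residue degrees $[\tilde{\mathcal{O}}/\mathfrak{P}:\mathcal{O}/\mathfrak{p}]$ of the primes $\mathfrak{P}$ of $\tilde{\mathcal{O}}$ over $\mathfrak{p}$. Then: 1. $\mathrm{Chow}(\mathcal{O}_{\mathfrak{p}})$ is trivial for every invertible maximal ideal $\mathfrak{p}$ of $\mathcal{O}$. 2. There are only finitely many non-invertible maximal ideals $\mathfrak{p}_1,\dots,\mathfrak{p}_r$ of $\mathcal{O}$, and $\mathrm{Chow}(\mathcal{O}_{\mathfrak{p}_i})\cong\mathbb{Z}/g_{\mathfrak{p}_i}\mathbb{Z}$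 for $1\le i\le r$. 3. The homomorphism $f_*$ induces a homomorphism $\overline{f_*}\colon\mathrm{Chow}(\tilde{\mathcal{O}})\to\mathrm{Chow}(\mathcal{O})$, $[D]\mapsto[f_*D]$, and there is an exact sequence $$0\to\mathrm{im}(\overline{f_*})\to\mathrm{Chow}(\mathcal{O})\to\bigoplus_{i=1}^r\mathrm{Chow}(\mathcal{O}_{\mathfrak{p}_i})\to0,$$ in which the second map is the inclusion and the third is the well-defined canonical projection $\left[\sum_{\mathfrak{p}}a_{\mathfrak{p}}\mathfrak{p}\right]\mapsto\left([a_{\mathfrak{p}_i}\,\mathfrak{p}_i\mathcal{O}_{\mathfrak{p}_i}]\right)_{i}$. 4. The set $\mathcal{R}=\{[\mathfrak{A}]\mid\mathrm{div}_{\tilde{\mathcal{O}}}(\mathfrak{A})\in\ker f_*\}$ is a subgroup of $\mathrm{Cl}(\tilde{\mathcal{O}})$, and $[\mathfrak{A}]\mapsto\overline{f_*}[\mathrm{div}_{\tilde{\mathcal{O}}}(\mathfrak{A})]$ induces an isomorphism $\mathrm{Cl}(\tilde{\mathcal{O}})/\mathcal{R}\cong\mathrm{im}(\overline{f_*})$.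 Moreover $\bigoplus_{i=1}^r\mathrm{Chow}(\mathcal{O}_{\mathfrak{p}_i})\cong\bigoplus_{i=1}^r\mathbb{Z}/g_{\mathfrak{p}_i}\mathbb{Z}$. -/

import Mathlib

open scoped nonZeroDivisors DirectSum

noncomputable section

namespace ChowDomain

/-! ### Divisors and the Chow group of a one-dimensional noetherian domain -/

section Localization

/-- A localization of a domain of dimension at most one has dimension at most one. -/
instance krullDimLE_atPrime (R : Type*) [CommRing R] [IsDomain R] [Ring.KrullDimLE 1 R]
    (p : Ideal R) [p.IsPrime] : Ring.KrullDimLE 1 (Localization.AtPrime p) := by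
  rw [Ring.krullDimLE_iff, IsLocalization.AtPrime.ringKrullDim_eq_height p]
  exact (Ideal.height_le_ringKrullDim_of_ne_top (Ideal.IsPrime.ne_top inferInstance)).trans
    (Ring.krullDimLE_iff.mp inferInstance)

theorem algebraMap_atPrime_mem {R : Type*} [CommRing R] [IsDomain R]
    (p : Ideal R) [p.IsPrime] {a : R} (ha : a ∈ R⁰) :
    algebraMap R (Localization.AtPrime p) a ∈ (Localization.AtPrime p)⁰ :=
  mem_nonZeroDivisors_of_ne_zero fun h => nonZeroDivisors.ne_zero ha
    ((IsLocalization.to_map_eq_zero_iff (Localization.AtPrime p)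
      p.primeCompl_le_nonZeroDivisors).mp h)

end Localization

section Divisors

variable (R : Type*) [CommRing R]

/-- The group of divisors: the free abelian group on the set of maximal ideals. -/
abbrev Divisor : Type _ := MaximalSpectrum R →₀ ℤ

variable [IsDomain R] [IsNoetherianRing R] [Ring.KrullDimLE 1 R]
variable (K : Type*) [Field K] [Algebra R K] [IsFractionRing R K]

variable {R} in
/-- The order homomorphism at `p` on the fraction field (written multiplicatively, with `0 ↦ 0`):
the unique extension to `K` of `a ↦ length (R_p / a R_p)` on the nonzero elements of `R`. -/
def ordHom (p : MaximalSpectrum R) : K →*₀ WithZero (Multiplicative ℤ) :=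
  (IsLocalization.toLocalizationMap R⁰ K).lift₀
    ((Ring.ordMonoidWithZeroHom (Localization.AtPrime p.asIdeal)).comp
      (algebraMap R (Localization.AtPrime p.asIdeal)).toMonoidWithZeroHom)
    fun y => Ring.ordMonoidWithZeroHom_isUnit (Localization.AtPrime p.asIdeal)
      ⟨_, algebraMap_atPrime_mem p.asIdeal y.2⟩

variable {R K} in
/-- `ord_p : Kˣ → ℤ`. -/
def ordAt (p : MaximalSpectrum R) (x : Kˣ) : ℤ := WithZero.log (ordHom K p (x : K))

variable {R K} in
theorem ordAt_mul (p : MaximalSpectrum R) (x y : Kˣ) :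
    ordAt p (x * y) = ordAt p x + ordAt p y := by
  simp only [ordAt, Units.val_mul, map_mul]
  exact WithZero.log_mul (by simp) (by simp)

variable {R K} in
theorem ordHom_algebraMap (p : MaximalSpectrum R) (a : R) :
    ordHom K p (algebraMap R K a) = Ring.ordMonoidWithZeroHom (Localization.AtPrime p.asIdeal)
      (algebraMap R (Localization.AtPrime p.asIdeal) a) :=
  (IsLocalization.toLocalizationMap R⁰ K).lift_eq _ a

/-- `ord_p (a / b) = length (R_p / a R_p) - length (R_p / b R_p)`. -/
theorem ordAt_eq_length_sub_length (p : MaximalSpectrum R) (x : Kˣ) (a b : R) (ha : a ≠ 0)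
    (hb : b ≠ 0) (hx : (x : K) = algebraMap R K a / algebraMap R K b) :
    ordAt p x =
      ((Module.length (Localization.AtPrime p.asIdeal) (Localization.AtPrime p.asIdeal ⧸
        Ideal.span {algebraMap R (Localization.AtPrime p.asIdeal) a})).toNat : ℤ) -
      ((Module.length (Localization.AtPrime p.asIdeal) (Localization.AtPrime p.asIdeal ⧸
        Ideal.span {algebraMap R (Localization.AtPrime p.asIdeal) b})).toNat : ℤ) := by
  have key : ∀ c : R, c ≠ 0 → ordHom K p (algebraMap R K c) =
      WithZero.exp ((Module.length (Localization.AtPrime p.asIdeal)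
        (Localization.AtPrime p.asIdeal ⧸
        Ideal.span {algebraMap R (Localization.AtPrime p.asIdeal) c})).toNat : ℤ) := by
    intro c hc
    have hc' := algebraMap_atPrime_mem p.asIdeal (mem_nonZeroDivisors_of_ne_zero hc)
    rw [ordHom_algebraMap]
    exact Ring.ordMonoidWithZeroHom_eq_coe _ hc' (ENat.natCast_toNat (Ring.ord_ne_top hc')).symm
  rw [ordAt, hx, map_div₀, key a ha, key b hb, WithZero.log_div (by simp) (by simp)]
  simp

variable {R} in
theorem ordHom_eq_one_of_notMem (p : MaximalSpectrum R) {a : R} (ha : a ∉ p.asIdeal) :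
    ordHom K p (algebraMap R K a) = 1 := by
  have hu : IsUnit (algebraMap R (Localization.AtPrime p.asIdeal) a) :=
    IsLocalization.map_units (M := p.asIdeal.primeCompl) _ ⟨a, ha⟩
  rw [ordHom_algebraMap, Ring.ordMonoidWithZeroHom_eq_coe _ hu.mem_nonZeroDivisors
    (n := 0) (by simpa using Ring.ord_of_isUnit hu)]
  simp

variable {R} in
/-- A nonzero element lies in only finitely many maximal ideals. -/
theorem finite_maximal_mem {a : R} (ha : a ≠ 0) :
    {p : MaximalSpectrum R | a ∈ p.asIdeal}.Finite := by
  have hfl := isFiniteLength_quotient_span_singleton R (mem_nonZeroDivisors_of_ne_zero ha)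
  rw [isFiniteLength_iff_isNoetherian_isArtinian] at hfl
  have := hfl.2
  have hA : IsArtinianRing (R ⧸ Ideal.span {a}) :=
    isArtinian_of_tower R this
  have hfin : Finite (PrimeSpectrum (R ⧸ Ideal.span {a})) := inferInstance
  have hrange := Set.finite_range (PrimeSpectrum.comap (Ideal.Quotient.mk (Ideal.span {a})))
  refine Set.Finite.of_finite_image (f := MaximalSpectrum.toPrimeSpectrum)
    (hrange.subset ?_) (MaximalSpectrum.toPrimeSpectrum_injective.injOn)
  rintro _ ⟨p, hp, rfl⟩
  rw [range_comap_of_surjective _ _ Ideal.Quotient.mk_surjective]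
  have hp' : a ∈ p.asIdeal := hp
  simpa [PrimeSpectrum.mem_zeroLocus, Ideal.mk_ker, MaximalSpectrum.toPrimeSpectrum] using hp'

theorem finite_support_ordAt (x : Kˣ) :
    (Function.support fun p : MaximalSpectrum R => ordAt p x).Finite := by
  obtain ⟨a, b, hb, hx⟩ := IsFractionRing.div_surjective (A := R) (x : K)
  have hb0 : b ≠ 0 := nonZeroDivisors.ne_zero hb
  have ha0 : a ≠ 0 := by
    rintro rfl
    exact x.ne_zero (by simp [← hx])
  refine ((finite_maximal_mem ha0).union (finite_maximal_mem hb0)).subset fun p hp => ?_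
  by_contra hcon
  simp only [Set.mem_union, Set.mem_ofPred_eq, not_or] at hcon
  refine hp ?_
  simp only [ordAt, ← hx, map_div₀, ordHom_eq_one_of_notMem K p hcon.1,
    ordHom_eq_one_of_notMem K p hcon.2]
  simp

/-- `div : Kˣ → Div R`, `a ↦ ∑_p ord_p(a) p`. -/
def divHom : Additive Kˣ →+ Divisor R :=
  AddMonoidHom.mk' (fun x => Finsupp.ofSupportFinite (fun p => ordAt p x.toMul)
    (finite_support_ordAt R K x.toMul)) fun x y => by
      ext p
      exact ordAt_mul p x.toMul y.toMul

/-- The subgroup of principal divisors. -/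
def principalDivisors : AddSubgroup (Divisor R) := (divHom R K).range

/-- The Chow group of a one-dimensional noetherian domain `R` with field of fractions `K`:
divisors modulo principal divisors. -/
abbrev Chow : Type _ := Divisor R ⧸ principalDivisors R K

/-- The class of a divisor in the Chow group. -/
abbrev Chow.mk : Divisor R →+ Chow R K := QuotientAddGroup.mk' (principalDivisors R K)

/-- The Chow group of `R`, formed with the standard model `FractionRing R` of its field of
fractions. -/
abbrev FracChow : Type _ := Chow R (FractionRing R)

/-- The class of a divisor in `FracChow R`. -/
abbrev FracChow.mk : Divisor R →+ FracChow R := Chow.mk R (FractionRing R)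

end Divisors

/-! ### Push-forward of divisors -/

section Pushforward

variable (A B : Type*) [CommRing A] [CommRing B] [Algebra A B] [Algebra.IsIntegral A B]

variable {B} in
/-- `P ↦ P ∩ A` on maximal ideals, for an integral extension. -/
def contract (P : MaximalSpectrum B) : MaximalSpectrum A :=
  ⟨P.asIdeal.under A, have := P.isMaximal; inferInstance⟩

/-- The push-forward `f_* : Div B → Div A`, `P ↦ [B/P : A/(P ∩ A)] (P ∩ A)`. -/
def pushforward : Divisor B →+ Divisor A :=
  Finsupp.liftAddHom fun P =>
    (Finsupp.singleAddHom (contract A P)).comp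
      (AddMonoidHom.mulLeft ((P.asIdeal.inertiaDeg A : ℕ) : ℤ))

/-- The greatest common divisor of the residue degrees of the primes of `B` over `p`. -/
def residueDegreeGCD [Module.Finite A B] (p : Ideal A) : ℕ :=
  (Algebra.QuasiFinite.finite_primesOver (S := B) p).toFinset.gcd fun P => P.inertiaDeg A

end Pushforward

/-! ### Divisors of fractional ideals of a Dedekind domain -/

section Dedekind

variable (S : Type*) [CommRing S] [IsDedekindDomain S]
variable (K : Type*) [Field K] [Algebra S K] [IsFractionRing S K]

variable {S K} in
open Classical in
/-- The exponent of the maximal ideal `P` in the factorization of the fractional ideal `I`.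
(Maximal ideals are nonzero unless `S` is a field, when the exponent is set to `0`.) -/
def exponent (I : (FractionalIdeal S⁰ K)ˣ) (P : MaximalSpectrum S) : ℤ :=
  if h : P.asIdeal = ⊥ then 0 else
    FractionalIdeal.count K ⟨P.asIdeal, P.isMaximal.isPrime, h⟩ (I : FractionalIdeal S⁰ K)

theorem finite_support_exponent (I : (FractionalIdeal S⁰ K)ˣ) :
    (Function.support (exponent I)).Finite := by
  have hf := FractionalIdeal.finite_factors (I : FractionalIdeal S⁰ K)
  rw [Filter.eventually_cofinite] at hf
  refine Set.Finite.of_finite_image (f := MaximalSpectrum.asIdeal)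
    ((hf.image fun v => v.asIdeal).subset ?_)
    (fun _ _ _ _ h => MaximalSpectrum.ext h)
  rintro _ ⟨P, hP, rfl⟩
  rw [Function.mem_support, exponent] at hP
  split_ifs at hP with h
  · exact absurd rfl hP
  · exact ⟨⟨P.asIdeal, P.isMaximal.isPrime, h⟩, hP, rfl⟩

/-- `div` on the group of (invertible) fractional ideals of a Dedekind domain:
`∏ P ^ e_P ↦ ∑ e_P P`. -/
def divIdeal : Additive (FractionalIdeal S⁰ K)ˣ →+ Divisor S :=
  AddMonoidHom.mk' (fun I => Finsupp.ofSupportFinite (exponent I.toMul)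
    (finite_support_exponent S K I.toMul)) fun I J => by
      ext P
      change exponent (I.toMul * J.toMul) P = exponent I.toMul P + exponent J.toMul P
      unfold exponent
      split_ifs with h
      · simp
      · rw [Units.val_mul]
        exact FractionalIdeal.count_mul K _ I.toMul.ne_zero J.toMul.ne_zero

/-- The class `[I]` in the class group, written additively. -/
abbrev idealClass : Additive (FractionalIdeal S⁰ K)ˣ →+ Additive (ClassGroup S) :=
  MonoidHom.toAdditive (ClassGroup.mk K)

end Dedekind

/-! ### The normalization -/

section Normalization

variable (O : Type*) [CommRing O] [IsDomain O] (K : Type*) [Field K] [Algebra O K]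
  [IsFractionRing O K]

/-- `K` is the field of fractions of the normalization. -/
instance isFractionRing_normalization : IsFractionRing (integralClosure O K) K :=
  integralClosure.isFractionRing_of_finite_extension K K

instance isIntegrallyClosed_normalization : IsIntegrallyClosed (integralClosure O K) :=
  integralClosure.isIntegrallyClosedOfFiniteExtension K

variable [Module.Finite O (integralClosure O K)]

instance isNoetherianRing_normalization [IsNoetherianRing O] :
    IsNoetherianRing (integralClosure O K) :=
  IsNoetherianRing.of_finite O _

instance dimensionLEOne_normalization [Ring.KrullDimLE 1 O] :
    Ring.DimensionLEOne (integralClosure O K) := by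
  have : Ring.DimensionLEOne O := ⟨fun hI hI' => hI'.isMaximal_of_ne_bot hI⟩
  exact Ring.DimensionLEOne.integralClosure ..

instance isDedekindDomain_normalization [IsNoetherianRing O] [Ring.KrullDimLE 1 O] :
    IsDedekindDomain (integralClosure O K) where

end Normalization

/-! ### Local Chow groups and the relations in the class group of the normalization -/

section Global

variable (O : Type*) [CommRing O] [IsDomain O] (K : Type*) [Field K] [Algebra O K]
  [IsFractionRing O K]

variable {O} in
/-- A maximal ideal of `O` that is invertible as a fractional ideal. -/
def IsInvertible (p : MaximalSpectrum O) : Prop :=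
  IsUnit (p.asIdeal : FractionalIdeal O⁰ K)

/-- The non-invertible maximal ideals of `O`. -/
abbrev NonInvertible : Type _ := {p : MaximalSpectrum O // ¬ IsInvertible K p}

variable {O} in
/-- The maximal ideal of the local ring `O_p`, as a point of its maximal spectrum. -/
def closedPoint (p : MaximalSpectrum O) : MaximalSpectrum (Localization.AtPrime p.asIdeal) :=
  ⟨IsLocalRing.maximalIdeal (Localization.AtPrime p.asIdeal), inferInstance⟩

variable [IsNoetherianRing O] [Ring.KrullDimLE 1 O]

variable {O} in
/-- The local Chow group: the Chow group of the localization `O_p`. -/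
abbrev LocalChow (p : MaximalSpectrum O) : Type _ :=
  FracChow (Localization.AtPrime p.asIdeal)

variable {O} in
/-- The class in the local Chow group of a divisor of `O_p`. -/
abbrev LocalChow.mk (p : MaximalSpectrum O) :
    Divisor (Localization.AtPrime p.asIdeal) →+ LocalChow p :=
  FracChow.mk (Localization.AtPrime p.asIdeal)

variable [Module.Finite O (integralClosure O K)]

/-- The subgroup `{[I] | div I ∈ ker f_*}` of the class group of the normalization. -/
def relations : AddSubgroup (Additive (ClassGroup (integralClosure O K))) :=
  ((pushforward O (integralClosure O K)).comp (divIdeal (integralClosure O K) K)).ker.map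
    (idealClass (integralClosure O K) K)

end Global

end ChowDomain

end

noncomputable section

namespace ChowDomain

/-! ### The length of a module at a prime -/

section LocalLength

variable {R : Type*} [CommRing R] (p : Ideal R) [p.IsPrime]

/-! Write `A` for the ring, `B` for its normalization and `g_p` for the gcd of the residue degrees
over `p`. Everything rests on `ord_p = ∑ [B/P : A/p] ord_P`, summed over the primes `P` above `p`
(`ordAt_eq_sum_fiber`). For `a` in `A` it holds because `A/aA` and `B/aB` have the same length at
`p` (`B/A` has finite length and is isomorphic to `aB/aA`), and because the composition factors of
`B/aB` can be sorted by the primes of `B`. In other words `f_* ∘ div_B = div_A`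
(`pushforward_divHom`), so `f_*` descends to Chow groups.

Since `B` has elements with a simple zero at one prime over `p` and no zero at the others, the
identity gives `ord_p(Kˣ) = g_p ℤ` (`exists_ordAt_eq_iff`). The ring `A_p` has a single maximal
ideal, so its Chow group is `ℤ / g_p`. An invertible `p` is locally principal, hence `ord_p` takes
the value 1 and `g_p = 1`. Every non-invertible `p` contains a fixed nonzero conductor element, so
there are finitely many.

A divisor is a push-forward iff `g_p` divides its coefficient at each `p`
(`mem_range_pushforward_iff`). This is automatic at invertible `p` and says at the others that the
local class vanishes, which is exactness in the middle. Finally, if `f_* div(I) = div_A(x) = f_*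
div(xB)`, then `x⁻¹I` has the class of `I` and lies in the kernel of `f_* ∘ div`; this identifies
the relations in the class group (`idealToChow_eq_zero_iff`). -/

/-- The length over `R_p` of the localization of the `R`-module `M` at `p`. -/
def localLength (M : Type*) [AddCommGroup M] [Module R M] : ℕ∞ :=
  Module.length (Localization.AtPrime p) (LocalizedModule p.primeCompl M)

variable {M N P : Type*} [AddCommGroup M] [Module R M] [AddCommGroup N] [Module R N]
  [AddCommGroup P] [Module R P]

theorem localLength_eq_add_of_exact (f : N →ₗ[R] M) (g : M →ₗ[R] P) (hf : Function.Injective f)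
    (hg : Function.Surjective g) (H : Function.Exact f g) :
    localLength p M = localLength p N + localLength p P :=
  Module.length_eq_add_of_exact (LocalizedModule.map p.primeCompl f)
    (LocalizedModule.map p.primeCompl g)
    (IsLocalizedModule.map_injective p.primeCompl (LocalizedModule.mkLinearMap _ _)
      (LocalizedModule.mkLinearMap _ _) f hf)
    (IsLocalizedModule.map_surjective p.primeCompl (LocalizedModule.mkLinearMap _ _)
      (LocalizedModule.mkLinearMap _ _) g hg)
    (LocalizedModule.map_exact p.primeCompl f g H)

theorem localLength_congr (e : M ≃ₗ[R] N) : localLength p M = localLength p N :=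
  (IsLocalizedModule.mapEquiv p.primeCompl (LocalizedModule.mkLinearMap p.primeCompl M)
    (LocalizedModule.mkLinearMap p.primeCompl N) (Localization.AtPrime p) e).length_eq

theorem localLength_eq_add (L : Submodule R M) :
    localLength p M = localLength p L + localLength p (M ⧸ L) :=
  localLength_eq_add_of_exact p L.subtype L.mkQ L.injective_subtype L.mkQ_surjective
    (LinearMap.exact_subtype_mkQ L)

theorem localLength_of_subsingleton [Subsingleton M] : localLength p M = 0 :=
  Module.length_eq_zero_iff.mpr inferInstance

theorem localLength_pi (n : ℕ) : localLength p (Fin n → M) = n * localLength p M := by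
  induction n with
  | zero => simp [localLength_of_subsingleton]
  | succ n ih =>
    rw [localLength_congr p (Fin.consLinearEquiv R fun _ : Fin (n + 1) => M).symm,
      localLength_eq_add_of_exact p (LinearMap.inl R M (Fin n → M)) (LinearMap.snd R M _)
        LinearMap.inl_injective LinearMap.snd_surjective .inl_snd, ih]
    push_cast
    ring

/-- Localization commutes with quotients, which links `localLength` to the lengths defining `ord_p`.
-/
theorem localLength_quotient (I : Ideal R) :
    localLength p (R ⧸ I) = Module.length (Localization.AtPrime p)
      (Localization.AtPrime p ⧸ I.map (algebraMap R (Localization.AtPrime p))) := by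
  rw [← Ideal.localized'_eq_map (Localization.AtPrime p) p.primeCompl I]
  have e := IsLocalizedModule.mapEquiv p.primeCompl
    (LocalizedModule.mkLinearMap p.primeCompl (R ⧸ I))
    (Submodule.toLocalizedQuotient' (Localization.AtPrime p) p.primeCompl
      (Algebra.linearMap R (Localization.AtPrime p)) I)
    (Localization.AtPrime p) (LinearEquiv.refl R (R ⧸ I))
  exact e.length_eq

theorem localLength_quotient_span_singleton (a : R) :
    localLength p (R ⧸ Ideal.span {a}) = Module.length (Localization.AtPrime p)
      (Localization.AtPrime p ⧸ Ideal.span {algebraMap R (Localization.AtPrime p) a}) :=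
  (localLength_quotient p _).trans (Submodule.quotEquivOfEq _ _
    (by simp only [Ideal.map_span, Set.image_singleton])).length_eq

theorem localLength_quotient_self : localLength p (R ⧸ p) = 1 := by
  rw [localLength_quotient, Localization.AtPrime.map_eq_maximalIdeal, Module.length_eq_one_iff]
  exact isSimpleModule_iff_isCoatom.mpr (IsLocalRing.maximalIdeal.isMaximal _).out

theorem localLength_quotient_of_not_le {I : Ideal R} (h : ¬ I ≤ p) :
    localLength p (R ⧸ I) = 0 := by
  obtain ⟨s, hs, hsp⟩ := Set.not_subset.mp h
  rw [localLength_quotient, Module.length_eq_zero_iff, Submodule.Quotient.subsingleton_iff]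
  exact Ideal.eq_top_of_isUnit_mem _ (Ideal.mem_map_of_mem _ hs)
    (IsLocalization.map_units _ (⟨s, hsp⟩ : p.primeCompl))

-- Simple modules are detected only at their own maximal ideal, so `localLength` at a maximal `p`
-- counts the composition factors isomorphic to `R/p`.
open Classical in
theorem localLength_quotient_maximal (q : Ideal R) [hq : q.IsMaximal] :
    localLength p (R ⧸ q) = if q = p then 1 else 0 := by
  split_ifs with h
  · subst h
    exact localLength_quotient_self q
  · exact localLength_quotient_of_not_le p fun hle =>
      h (hq.eq_of_le (Ideal.IsPrime.ne_top inferInstance) hle)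

theorem localLength_ne_top (h : IsFiniteLength R M) : localLength p M ≠ ⊤ := by
  classical
  induction h with
  | of_subsingleton => simp [localLength_of_subsingleton]
  | of_simple_quotient _ ih =>
    rename_i N hs _
    obtain ⟨m, hm, ⟨e⟩⟩ := isSimpleModule_iff_quot_maximal.mp hs
    rw [localLength_eq_add p N, localLength_congr p e, localLength_quotient_maximal]
    refine (ENat.add_lt_top.mpr ⟨ih.lt_top, ?_⟩).ne
    split_ifs <;> simp

/-- The localization of a module over a local ring at the maximal ideal is the module itself. -/
theorem localLength_maximalIdeal [IsLocalRing R] :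
    localLength (IsLocalRing.maximalIdeal R) M = Module.length R M := by
  have hu : ∀ s : (IsLocalRing.maximalIdeal R).primeCompl, IsUnit (s : R) := fun s =>
    not_not.mp s.2
  have : IsLocalization (IsLocalRing.maximalIdeal R).primeCompl R :=
    IsLocalization.of_le_isUnit fun s hs => hu ⟨s, hs⟩
  have := isLocalizedModule_id (IsLocalRing.maximalIdeal R).primeCompl M R
  have e := IsLocalizedModule.linearEquiv (IsLocalRing.maximalIdeal R).primeCompl
    (LinearMap.id : M →ₗ[R] M)
    (LocalizedModule.mkLinearMap (IsLocalRing.maximalIdeal R).primeCompl M)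
  rw [e.length_eq, localLength]
  -- As `R` surjects onto its localization, a module over the latter has the same submodules over
  -- both rings.
  refine (Module.length_eq_of_surjective ?_).symm
  exact (IsLocalization.atUnits R (IsLocalRing.maximalIdeal R).primeCompl
    (S := Localization.AtPrime (IsLocalRing.maximalIdeal R)) fun s hs => hu ⟨s, hs⟩).surjective

end LocalLength

/-! ### Orders as differences of local lengths -/

section Order

variable {R : Type*} [CommRing R] [IsDomain R] [IsNoetherianRing R] [Ring.KrullDimLE 1 R]
  {K : Type*} [Field K] [Algebra R K] [IsFractionRing R K]

theorem ordAt_eq_localLength_sub (p : MaximalSpectrum R) (x : Kˣ) (a b : R) (ha : a ≠ 0)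
    (hb : b ≠ 0) (hx : (x : K) = algebraMap R K a / algebraMap R K b) :
    ordAt p x = ((localLength p.asIdeal (R ⧸ Ideal.span {a})).toNat : ℤ) -
      ((localLength p.asIdeal (R ⧸ Ideal.span {b})).toNat : ℤ) := by
  rw [ordAt_eq_length_sub_length R K p x a b ha hb hx]
  simp only [localLength_quotient_span_singleton]

theorem localLength_span_singleton_ne_top (p : Ideal R) [p.IsPrime] {a : R} (ha : a ≠ 0) :
    localLength p (R ⧸ Ideal.span {a}) ≠ ⊤ :=
  localLength_ne_top p
    (isFiniteLength_quotient_span_singleton R (mem_nonZeroDivisors_of_ne_zero ha))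

theorem exists_algebraMap_div_algebraMap (R : Type*) [CommRing R] [IsDomain R]
    {K : Type*} [Field K] [Algebra R K] [IsFractionRing R K] (x : Kˣ) :
    ∃ a b : R, a ≠ 0 ∧ b ≠ 0 ∧ (x : K) = algebraMap R K a / algebraMap R K b := by
  obtain ⟨a, b, hb, hx⟩ := IsFractionRing.div_surjective (A := R) (x : K)
  refine ⟨a, b, ?_, nonZeroDivisors.ne_zero hb, hx.symm⟩
  rintro rfl
  exact x.ne_zero (by simp [← hx])

@[simp]
theorem divHom_apply (x : Additive Kˣ) (p : MaximalSpectrum R) :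
    divHom R K x p = ordAt p x.toMul := rfl

/-- The unit of the fraction field defined by a nonzero element of the domain. -/
def unitOfNeZero (R : Type*) [CommRing R] (K : Type*) [Field K] [Algebra R K]
    [IsFractionRing R K] {a : R} (ha : a ≠ 0) : Kˣ :=
  Units.mk0 (algebraMap R K a) (by simpa using ha)

theorem ordAt_unitOfNeZero (p : MaximalSpectrum R) {a : R} (ha : a ≠ 0) :
    ordAt p (unitOfNeZero R K ha) = ((localLength p.asIdeal (R ⧸ Ideal.span {a})).toNat : ℤ) := by
  rw [ordAt_eq_localLength_sub p _ a 1 ha one_ne_zero (by simp [unitOfNeZero]),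
    localLength_quotient_of_not_le p.asIdeal (I := Ideal.span {1})
      (by simpa using p.isMaximal.ne_top)]
  simp

end Order

/-! ### Lengths along a finite extension -/

section Extension

variable {A B : Type*} [CommRing A] [CommRing B] [Algebra A B] [Module.Finite A B]

/-- The maximal ideals of `B` over the maximal ideal `p` of `A`. -/
def fiber (B : Type*) [CommRing B] [Algebra A B] [Module.Finite A B] (p : MaximalSpectrum A) :
    Finset (MaximalSpectrum B) :=
  Set.Finite.toFinset (s := {P : MaximalSpectrum B | contract A P = p}) <| by
    refine Set.Finite.of_finite_image (f := MaximalSpectrum.asIdeal)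
      ((Algebra.QuasiFinite.finite_primesOver (S := B) p.asIdeal).subset ?_)
      (fun _ _ _ _ h => MaximalSpectrum.ext h)
    rintro _ ⟨P, hP, rfl⟩
    exact ⟨P.isMaximal.isPrime, ⟨congrArg MaximalSpectrum.asIdeal (Eq.symm hP)⟩⟩

theorem mem_fiber {p : MaximalSpectrum A} {P : MaximalSpectrum B} :
    P ∈ fiber B p ↔ contract A P = p := by
  simp [fiber]

/-- `B/P` is a finite-dimensional vector space over `A/(P ∩ A)`, hence over `A` a power of that
residue field. -/
theorem localLength_residue (p : Ideal A) [p.IsPrime] (P : MaximalSpectrum B) :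
    localLength p (B ⧸ P.asIdeal) =
      P.asIdeal.inertiaDeg A * localLength p (A ⧸ (contract A P).asIdeal) := by
  have := P.isMaximal
  have := (contract A P).isMaximal
  let := Ideal.Quotient.field (contract A P).asIdeal
  have hlo : P.asIdeal.LiesOver (contract A P).asIdeal := ⟨rfl⟩
  rw [Ideal.inertiaDeg_eq_of_isMaximal (contract A P).asIdeal P.asIdeal]
  let b := Module.finBasis (A ⧸ (contract A P).asIdeal) (B ⧸ P.asIdeal)
  rw [localLength_congr p (b.equivFun.restrictScalars A), localLength_pi]

/-- Induction along a composition series over `B`: a factor `B/m` adds its residue degree on the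
left exactly when `m` lies over `p`, and then the same amount to the single summand `P = m`. The
`A`-structure is quantified last so that the induction hypothesis applies to submodules. -/
theorem localLength_eq_sum_fiber (p : MaximalSpectrum A) {N : Type*} [AddCommGroup N] [Module B N]
    (h : IsFiniteLength B N) : ∀ [Module A N] [IsScalarTower A B N], localLength p.asIdeal N =
      ∑ P ∈ fiber B p, (P.asIdeal.inertiaDeg A : ℕ∞) * localLength P.asIdeal N := by
  classical
  induction h with
  | of_subsingleton =>
    intros
    simp [localLength_of_subsingleton]
  | of_simple_quotient _ ih =>
    rename_i M _ _ L hs _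
    intro _ _
    obtain ⟨m, hm, ⟨e⟩⟩ := isSimpleModule_iff_quot_maximal.mp hs
    have hadd : localLength p.asIdeal M =
        localLength p.asIdeal L + localLength p.asIdeal (M ⧸ L) :=
      localLength_eq_add_of_exact p.asIdeal (L.subtype.restrictScalars A)
        (L.mkQ.restrictScalars A) L.injective_subtype L.mkQ_surjective
        (LinearMap.exact_subtype_mkQ L)
    have hres := localLength_residue p.asIdeal (⟨m, hm⟩ : MaximalSpectrum B)
    have hp := (contract A (⟨m, hm⟩ : MaximalSpectrum B)).isMaximal
    rw [localLength_quotient_maximal] at hres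
    rw [hadd, ih, localLength_congr p.asIdeal (e.restrictScalars A), hres]
    simp_rw [localLength_eq_add _ L, mul_add, Finset.sum_add_distrib]
    congr 1
    have hsum : ∀ P ∈ fiber B p, (P.asIdeal.inertiaDeg A : ℕ∞) * localLength P.asIdeal (M ⧸ L) =
        if (⟨m, hm⟩ : MaximalSpectrum B) = P then (m.inertiaDeg A : ℕ∞) else 0 := by
      intro P _
      rw [localLength_congr P.asIdeal e, localLength_quotient_maximal]
      by_cases hP : (⟨m, hm⟩ : MaximalSpectrum B) = P
      · subst hP
        simp
      · rw [if_neg hP, if_neg fun h => hP (MaximalSpectrum.ext h), mul_zero]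
    rw [Finset.sum_congr rfl hsum, Finset.sum_ite_eq]
    simp only [mem_fiber, MaximalSpectrum.ext_iff, mul_ite, mul_one, mul_zero]

/-- The length of `M / aM` is the same for `A` and for a finite extension `B` of `A` such that
`B / A` has finite length. -/
theorem localLength_quotient_span_algebraMap {A B : Type*} [CommRing A] [CommRing B]
    [Algebra A B] [IsDomain B] [FaithfulSMul A B]
    (p : Ideal A) [p.IsPrime] {a : A} (ha : a ≠ 0)
    (hfin : localLength p (B ⧸ (Algebra.linearMap A B).range) ≠ ⊤) :
    localLength p (A ⧸ Ideal.span {a}) =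
      localLength p (B ⧸ Ideal.span {algebraMap A B a}) := by
  have hinj := FaithfulSMul.algebraMap_injective A B
  have ha' : algebraMap A B a ≠ 0 := by simpa using (map_ne_zero_iff _ hinj).mpr ha
  -- the length of `B / aA` is computed along `aA ⊆ A ⊆ B` and along `aA ⊆ aB ⊆ B`
  let R₀ : Submodule A B := (Algebra.linearMap A B).range
  let I : Submodule A B := (Ideal.span {algebraMap A B a}).restrictScalars A
  let J : Submodule A B := Submodule.map (Algebra.linearMap A B) (Ideal.span {a})
  have mem_J : ∀ y, y ∈ J ↔ ∃ x, algebraMap A B x * algebraMap A B a = y := fun y => by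
    simp [J, Ideal.mem_span_singleton']
  have mem_I : ∀ y, y ∈ I ↔ ∃ x, x * algebraMap A B a = y := fun y => by
    simp [I, Ideal.mem_span_singleton']
  have mem_R₀ : ∀ y, y ∈ R₀ ↔ ∃ x, algebraMap A B x = y := fun y => by simp [R₀]
  have hJR : J ≤ R₀ := LinearMap.map_le_range
  have hJI : J ≤ I := fun y hy => by
    obtain ⟨x, rfl⟩ := (mem_J y).mp hy
    exact (mem_I _).mpr ⟨_, rfl⟩
  let f₁ : (A ⧸ Ideal.span {a}) →ₗ[A] B ⧸ J :=
    Submodule.mapQ _ J (Algebra.linearMap A B) (Submodule.le_comap_map _ _)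
  -- Multiplication by `a` identifies `B/A` with `aB/aA`.
  let f₂ : (B ⧸ R₀) →ₗ[A] B ⧸ J :=
    Submodule.mapQ R₀ J (LinearMap.mulRight A (algebraMap A B a)) fun y hy => by
      obtain ⟨x, rfl⟩ := (mem_R₀ y).mp hy
      exact (mem_J _).mpr ⟨x, rfl⟩
  have h₁ := localLength_eq_add_of_exact p f₁ (Submodule.factor hJR)
    ((injective_iff_map_eq_zero _).mpr fun x hx => by
      obtain ⟨x, rfl⟩ := Submodule.Quotient.mk_surjective _ x
      obtain ⟨z, hz⟩ := (mem_J _).mp ((Submodule.Quotient.mk_eq_zero J).mp hx)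
      refine (Submodule.Quotient.mk_eq_zero _).mpr (Ideal.mem_span_singleton'.mpr ⟨z, hinj ?_⟩)
      rw [map_mul, hz, Algebra.linearMap_apply])
    (Submodule.factor_surjective hJR) fun y => by
      obtain ⟨y, rfl⟩ := Submodule.Quotient.mk_surjective _ y
      refine ⟨fun hy => ?_, ?_⟩
      · obtain ⟨x, rfl⟩ := (mem_R₀ y).mp ((Submodule.Quotient.mk_eq_zero R₀).mp hy)
        exact ⟨Submodule.Quotient.mk x, rfl⟩
      · rintro ⟨x, hx⟩
        obtain ⟨x, rfl⟩ := Submodule.Quotient.mk_surjective _ x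
        rw [← hx]
        exact (Submodule.Quotient.mk_eq_zero R₀).mpr ((mem_R₀ _).mpr ⟨x, rfl⟩)
  have h₂ := localLength_eq_add_of_exact p f₂ (Submodule.factor hJI)
    ((injective_iff_map_eq_zero _).mpr fun x hx => by
      obtain ⟨x, rfl⟩ := Submodule.Quotient.mk_surjective _ x
      obtain ⟨z, hz⟩ := (mem_J _).mp ((Submodule.Quotient.mk_eq_zero J).mp hx)
      exact (Submodule.Quotient.mk_eq_zero _).mpr ((mem_R₀ _).mpr ⟨z, mul_right_cancel₀ ha' hz⟩))
    (Submodule.factor_surjective hJI) fun y => by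
      obtain ⟨y, rfl⟩ := Submodule.Quotient.mk_surjective _ y
      refine ⟨fun hy => ?_, ?_⟩
      · obtain ⟨x, rfl⟩ := (mem_I y).mp ((Submodule.Quotient.mk_eq_zero I).mp hy)
        exact ⟨Submodule.Quotient.mk x, rfl⟩
      · rintro ⟨x, hx⟩
        obtain ⟨x, rfl⟩ := Submodule.Quotient.mk_surjective _ x
        rw [← hx]
        exact (Submodule.Quotient.mk_eq_zero I).mpr ((mem_I _).mpr ⟨x, rfl⟩)
  -- Both chains compute the length of `B/aA`, and the common term `B/A` cancels because it is
  -- finite.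
  rw [h₁, add_comm] at h₂
  exact ENat.add_right_injective_of_ne_top hfin h₂

end Extension

/-! ### Push-forward of principal divisors -/

section Pushforward

variable {A B : Type*} [CommRing A] [CommRing B] [Algebra A B] [Module.Finite A B]

theorem pushforward_single (P : MaximalSpectrum B) (n : ℤ) :
    pushforward A B (Finsupp.single P n) =
      Finsupp.single (contract A P) ((P.asIdeal.inertiaDeg A : ℤ) * n) := by
  simp [pushforward]

theorem pushforward_apply (D : Divisor B) (p : MaximalSpectrum A) :
    pushforward A B D p = ∑ P ∈ fiber B p, (P.asIdeal.inertiaDeg A : ℤ) * D P := by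
  classical
  induction D using Finsupp.induction_linear with
  | zero => simp
  | add D E hD hE => simp [hD, hE, mul_add, Finset.sum_add_distrib]
  | single P n =>
    simp only [pushforward_single, Finsupp.single_apply, mul_ite, mul_zero, Finset.sum_ite_eq,
      mem_fiber]

/-- A nonzero element of the conductor of a finite extension inside the field of fractions. -/
theorem exists_forall_smul_mem_range (A B K : Type*) [CommRing A] [IsDomain A] [CommRing B]
    [Algebra A B] [Module.Finite A B] [Field K] [Algebra A K] [IsFractionRing A K] [Algebra B K]
    [IsScalarTower A B K] [FaithfulSMul B K] :
    ∃ c : A, c ≠ 0 ∧ ∀ b : B, c • b ∈ (Algebra.linearMap A B).range := by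
  classical
  obtain ⟨s, hs⟩ := Module.Finite.fg_top (R := A) (M := B)
  -- `c` is a common denominator in `K` of finitely many module generators of `B`.
  obtain ⟨c, hc⟩ := IsLocalization.exist_integer_multiples_of_finset A⁰
    (s.image (algebraMap B K))
  refine ⟨c, nonZeroDivisors.ne_zero c.2, fun b => ?_⟩
  have hle : (⊤ : Submodule A B) ≤
      (Algebra.linearMap A B).range.comap (LinearMap.lsmul A B (c : A)) := by
    rw [← hs, Submodule.span_le]
    intro b hb
    obtain ⟨a, ha⟩ := hc _ (Finset.mem_image_of_mem _ hb)
    refine ⟨a, FaithfulSMul.algebraMap_injective B K ?_⟩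
    rw [Algebra.linearMap_apply, ← IsScalarTower.algebraMap_apply, ha, LinearMap.lsmul_apply,
      Algebra.smul_def, Algebra.smul_def, map_mul, ← IsScalarTower.algebraMap_apply]
  exact hle (Submodule.mem_top (x := b))

variable [IsDomain A] [IsNoetherianRing A] [Ring.KrullDimLE 1 A]
  [IsDomain B] [IsNoetherianRing B] [Ring.KrullDimLE 1 B]
  (K : Type*) [Field K] [Algebra A K] [IsFractionRing A K] [Algebra B K] [IsFractionRing B K]
  [IsScalarTower A B K]

/-- A conductor element `c` kills `B/A`, which is thus a finite module over the artinian ring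
`A/cA`. -/
theorem isFiniteLength_quotient_range (A B K : Type*) [CommRing A] [IsDomain A]
    [IsNoetherianRing A] [Ring.KrullDimLE 1 A] [CommRing B] [Algebra A B] [Module.Finite A B]
    [Field K] [Algebra A K] [IsFractionRing A K] [Algebra B K] [IsScalarTower A B K]
    [FaithfulSMul B K] :
    IsFiniteLength A (B ⧸ (Algebra.linearMap A B).range) := by
  obtain ⟨c, hc, hcB⟩ := exists_forall_smul_mem_range A B K
  rw [isFiniteLength_iff_isNoetherian_isArtinian]
  refine ⟨inferInstance, ?_⟩
  have hfl := isFiniteLength_quotient_span_singleton A (mem_nonZeroDivisors_of_ne_zero hc)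
  rw [isFiniteLength_iff_isNoetherian_isArtinian] at hfl
  have := hfl.2
  have : IsArtinianRing (A ⧸ Ideal.span {c}) := isArtinian_of_tower A this
  have ht : Module.IsTorsionBySet A (B ⧸ (Algebra.linearMap A B).range)
      (Ideal.span {c} : Ideal A) := by
    refine (Module.isTorsionBySet_span_singleton_iff c).mpr ?_
    intro x
    obtain ⟨x, rfl⟩ := Submodule.Quotient.mk_surjective _ x
    exact (Submodule.Quotient.mk_eq_zero _).mpr (hcB x)
  let := ht.module
  have := ht.isScalarTower (S := A)
  have : Module.Finite (A ⧸ Ideal.span {c}) (B ⧸ (Algebra.linearMap A B).range) :=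
    Module.Finite.of_restrictScalars_finite A _ _
  exact isArtinian_of_surjective_algebraMap (R := A ⧸ Ideal.span {c})
    Ideal.Quotient.mk_surjective

theorem ordAt_eq_sum_fiber (p : MaximalSpectrum A) (x : Kˣ) :
    ordAt p x = ∑ P ∈ fiber B p, (P.asIdeal.inertiaDeg A : ℤ) * ordAt P x := by
  have hinj : Function.Injective (algebraMap A B) := by
    have h := FaithfulSMul.algebraMap_injective A K
    rw [IsScalarTower.algebraMap_eq A B K] at h
    exact Function.Injective.of_comp (f := algebraMap B K) (by simpa using h)
  have : FaithfulSMul A B := (faithfulSMul_iff_algebraMap_injective A B).mpr hinj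
  have key : ∀ a : A, a ≠ 0 → ((localLength p.asIdeal (A ⧸ Ideal.span {a})).toNat : ℤ) =
      ∑ P ∈ fiber B p, (P.asIdeal.inertiaDeg A : ℤ) *
        ((localLength P.asIdeal (B ⧸ Ideal.span {algebraMap A B a})).toNat : ℤ) := by
    intro a ha
    have ha' : algebraMap A B a ≠ 0 := (map_ne_zero_iff _ hinj).mpr ha
    rw [localLength_quotient_span_algebraMap (B := B) p.asIdeal ha
      (localLength_ne_top _ (isFiniteLength_quotient_range A B K)),
      localLength_eq_sum_fiber p (isFiniteLength_quotient_span_singleton B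
        (mem_nonZeroDivisors_of_ne_zero ha')), ENat.toNat_sum]
    · simp
    · intro P _
      exact (WithTop.mul_lt_top (ENat.natCast_lt_top _)
        (localLength_span_singleton_ne_top P.asIdeal ha').lt_top).ne
  -- A fraction over `A` is also one over `B`, so the identity for elements of `A` suffices.
  obtain ⟨a, b, ha, hb, hx⟩ := exists_algebraMap_div_algebraMap A x
  rw [ordAt_eq_localLength_sub p x a b ha hb hx, key a ha, key b hb, ← Finset.sum_sub_distrib]
  refine Finset.sum_congr rfl fun P _ => ?_
  rw [ordAt_eq_localLength_sub P x _ _ ((map_ne_zero_iff _ hinj).mpr ha)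
    ((map_ne_zero_iff _ hinj).mpr hb) (by simpa only [← IsScalarTower.algebraMap_apply]), mul_sub]

theorem pushforward_divHom (x : Additive Kˣ) :
    pushforward A B (divHom B K x) = divHom A K x := by
  ext p
  simp only [pushforward_apply, divHom_apply, ordAt_eq_sum_fiber (B := B) K p]

end Pushforward

/-! ### The residue degree gcd -/

section ResidueDegree

variable {A B : Type*} [CommRing A] [CommRing B] [Algebra A B] [Module.Finite A B]

theorem residueDegreeGCD_dvd_inertiaDeg {p : MaximalSpectrum A} {P : MaximalSpectrum B}
    (hP : contract A P = p) : residueDegreeGCD A B p.asIdeal ∣ P.asIdeal.inertiaDeg A := by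
  subst hP
  refine Finset.gcd_dvd ?_
  rw [Set.Finite.mem_toFinset]
  exact ⟨P.isMaximal.isPrime, ⟨rfl⟩⟩

theorem residueDegreeGCD_dvd_pushforward (p : MaximalSpectrum A) (D : Divisor B) :
    (residueDegreeGCD A B p.asIdeal : ℤ) ∣ pushforward A B D p := by
  rw [pushforward_apply]
  exact Finset.dvd_sum fun P hP => Dvd.dvd.mul_right
    (Int.natCast_dvd_natCast.mpr (residueDegreeGCD_dvd_inertiaDeg (mem_fiber.mp hP))) _

/-- A subgroup of `ℤ` that contains the residue degrees contains their gcd. -/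
theorem residueDegreeGCD_mem (p : MaximalSpectrum A) (H : AddSubgroup ℤ)
    (h : ∀ P : MaximalSpectrum B, contract A P = p → (P.asIdeal.inertiaDeg A : ℤ) ∈ H) :
    (residueDegreeGCD A B p.asIdeal : ℤ) ∈ H := by
  classical
  have key : ∀ t : Finset (Ideal B), (∀ P ∈ t, ((P.inertiaDeg A : ℕ) : ℤ) ∈ H) →
      ((t.gcd fun P => P.inertiaDeg A : ℕ) : ℤ) ∈ H := by
    intro t
    induction t using Finset.induction with
    | empty => simp
    | insert P t _ ih =>
      intro ht
      rw [Finset.gcd_insert]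
      change ((Nat.gcd _ _ : ℕ) : ℤ) ∈ H
      rw [Nat.gcd_eq_gcd_ab, mul_comm, mul_comm (Nat.cast (t.gcd _))]
      exact H.add_mem (H.zsmul_mem (ht P (Finset.mem_insert_self _ _)) _)
        (H.zsmul_mem (ih fun Q hQ => ht Q (Finset.mem_insert_of_mem hQ)) _)
  refine key _ fun P hP => ?_
  obtain ⟨_, hlo⟩ := (Set.Finite.mem_toFinset _).mp hP
  have := p.isMaximal
  have hmax : P.IsMaximal := Ideal.IsMaximal.of_liesOver_isMaximal P p.asIdeal
  exact h ⟨P, hmax⟩ (MaximalSpectrum.ext hlo.over.symm)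

/-- `f_*` maps the span of the primes over `p` into `ℤ p`, with image generated by the residue
degrees, that is by their gcd. -/
theorem mem_range_pushforward_iff (D : Divisor A) :
    D ∈ (pushforward A B).range ↔
      ∀ p : MaximalSpectrum A, (residueDegreeGCD A B p.asIdeal : ℤ) ∣ D p := by
  refine ⟨?_, fun h => ?_⟩
  · rintro ⟨E, rfl⟩ p
    exact residueDegreeGCD_dvd_pushforward p E
  · rw [← Finsupp.sum_single D]
    refine AddSubgroup.sum_mem _ fun p _ => ?_
    obtain ⟨k, hk⟩ := h p
    have := residueDegreeGCD_mem (B := B) p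
      ((pushforward A B).range.comap (Finsupp.singleAddHom p)) fun P hP => by
        subst hP
        exact ⟨Finsupp.single P 1, by simp [pushforward_single]⟩
    rw [hk, mul_comm]
    exact AddSubgroup.zsmul_mem _ this k

end ResidueDegree

/-! ### The values of the order homomorphism -/

section Values

theorem localLength_quotient_mul_of_not_le {R : Type*} [CommRing R] (q : Ideal R) [q.IsPrime]
    (I : Ideal R) {J : Ideal R} (h : ¬ J ≤ q) :
    localLength q (R ⧸ (I * J)) = localLength q (R ⧸ I) := by
  have hJ : J.map (algebraMap R (Localization.AtPrime q)) = ⊤ := by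
    obtain ⟨s, hs, hsq⟩ := Set.not_subset.mp h
    exact Ideal.eq_top_of_isUnit_mem _ (Ideal.mem_map_of_mem _ hs)
      (IsLocalization.map_units _ (⟨s, hsq⟩ : q.primeCompl))
  rw [localLength_quotient, localLength_quotient]
  exact (Submodule.quotEquivOfEq _ _ (by rw [Ideal.map_mul, hJ, Ideal.mul_top])).length_eq

open Classical in
/-- An element with a simple zero at `P` and no other zeros at the maximal ideals containing `M`. -/
theorem exists_localLength_span_eq {B : Type*} [CommRing B] [IsDedekindDomain B]
    (P : MaximalSpectrum B) {M : Ideal B} (hM : M ≠ ⊥) (hMP : M ≤ P.asIdeal) :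
    ∃ a : B, a ≠ 0 ∧ ∀ Q : MaximalSpectrum B, M ≤ Q.asIdeal →
      localLength Q.asIdeal (B ⧸ Ideal.span {a}) = if P = Q then 1 else 0 := by
  have hP : P.asIdeal ≠ ⊥ := fun h => hM (le_bot_iff.mp (h ▸ hMP))
  -- Choose `a` with `PM + (a) = P`. Writing `(a) = PJ` and cancelling `P` gives `M + J = 1`, so no
  -- maximal ideal containing `M` contains `J`.
  obtain ⟨a, ha⟩ := IsDedekindDomain.exists_sup_span_eq
    (Ideal.mul_le_left (I := P.asIdeal) (J := M)) (mul_ne_zero hP hM)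
  have haP : Ideal.span {a} ≤ P.asIdeal := le_sup_right.trans ha.le
  obtain ⟨J, hJ⟩ := Ideal.dvd_iff_le.mpr haP
  rw [hJ, ← Ideal.mul_sup] at ha
  have hMJ : M ⊔ J = ⊤ := mul_left_cancel₀ hP (by rw [ha, Ideal.mul_top])
  refine ⟨a, ?_, fun Q hQ => ?_⟩
  · rintro rfl
    have hJ0 : J = ⊥ := by
      have : P.asIdeal * J = 0 := by rw [← hJ]; simp
      exact (mul_eq_zero.mp this).resolve_left hP
    rw [hJ0, sup_bot_eq] at hMJ
    exact P.isMaximal.ne_top (top_le_iff.mp (hMJ ▸ hMP))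
  · have hJQ : ¬ J ≤ Q.asIdeal := fun h =>
      Q.isMaximal.ne_top (top_le_iff.mp (hMJ ▸ sup_le hQ h))
    have := P.isMaximal
    rw [hJ, localLength_quotient_mul_of_not_le _ _ hJQ, localLength_quotient_maximal]
    simp only [MaximalSpectrum.ext_iff]

variable {A B : Type*} [CommRing A] [CommRing B] [Algebra A B] [Module.Finite A B]
  [IsDomain A] [IsNoetherianRing A] [Ring.KrullDimLE 1 A] [IsDedekindDomain B]
  (K : Type*) [Field K] [Algebra A K] [IsFractionRing A K] [Algebra B K] [IsFractionRing B K]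
  [IsScalarTower A B K]

theorem maximal_ne_bot {R : Type*} [CommRing R] [Nontrivial R] (hR : ¬ IsField R)
    (p : MaximalSpectrum R) : p.asIdeal ≠ ⊥ :=
  Ring.ne_bot_of_isMaximal_of_not_isField p.isMaximal hR

/-- The image of `ord_p` is generated by the gcd of the residue degrees over `p`. -/
theorem exists_ordAt_eq_iff (hA : ¬ IsField A) (p : MaximalSpectrum A) (n : ℤ) :
    (∃ x : Kˣ, ordAt p x = n) ↔ (residueDegreeGCD A B p.asIdeal : ℤ) ∣ n := by
  classical
  refine ⟨?_, ?_⟩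
  · rintro ⟨x, rfl⟩
    have := residueDegreeGCD_dvd_pushforward p (divHom B K (Additive.ofMul x))
    rwa [pushforward_divHom] at this
  · rintro ⟨k, rfl⟩
    have hmem := residueDegreeGCD_mem (B := B) p
      ((Finsupp.applyAddHom p).comp (divHom A K)).range fun P hP => by
        have hinj : Function.Injective (algebraMap A B) := by
          have h := FaithfulSMul.algebraMap_injective A K
          rw [IsScalarTower.algebraMap_eq A B K] at h
          exact Function.Injective.of_comp (f := algebraMap B K) (by simpa using h)
        have hM : p.asIdeal.map (algebraMap A B) ≠ ⊥ :=
          (Ideal.map_eq_bot_iff_of_injective hinj).not.mpr (maximal_ne_bot hA p)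
        have hle : ∀ Q ∈ fiber B p, p.asIdeal.map (algebraMap A B) ≤ Q.asIdeal := fun Q hQ => by
          rw [Ideal.map_le_iff_le_comap, ← mem_fiber.mp hQ]
          exact le_rfl
        -- All primes over `p` contain `M = pB`, so only `P` contributes to `ord_p(a)`, which equals
        -- the residue degree of `P`.
        obtain ⟨a, ha, h⟩ := exists_localLength_span_eq P hM (hle P (mem_fiber.mpr hP))
        refine ⟨Additive.ofMul (unitOfNeZero B K ha), ?_⟩
        change ordAt p (unitOfNeZero B K ha) = _
        rw [ordAt_eq_sum_fiber (B := B), Finset.sum_eq_single P]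
        · rw [ordAt_unitOfNeZero, h P (hle P (mem_fiber.mpr hP))]
          simp
        · intro Q hQ hne
          rw [ordAt_unitOfNeZero, h Q (hle Q hQ), if_neg hne.symm]
          simp
        · exact fun h => absurd (mem_fiber.mpr hP) h
    obtain ⟨x, hx⟩ := AddSubgroup.zsmul_mem _ hmem k
    exact ⟨x.toMul, hx.trans (by rw [smul_eq_mul, mul_comm])⟩

end Values

/-! ### Invertible maximal ideals -/

section Invertible

variable {A : Type*} [CommRing A] (K : Type*) [Field K] [Algebra A K] [IsFractionRing A K]

/-- An invertible maximal ideal is locally principal. -/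
theorem IsInvertible.exists_mul_mem {p : MaximalSpectrum A} (hp : IsInvertible K p) :
    ∃ x ∈ p.asIdeal, ∃ u ∉ p.asIdeal, ∀ z ∈ p.asIdeal, u * z ∈ Ideal.span {x} := by
  obtain ⟨q, hq⟩ := hp.exists_right_inv
  by_contra! hcon
  -- For `x` in `p` and `y` in `q`, an element `u = xy` outside `p` would give `uz = (zy)x ∈ (x)`
  -- for all `z` in `p`, against `hcon`. So `pq ⊆ p`, which contradicts `pq = 1`.
  have hle : (p.asIdeal : FractionalIdeal A⁰ K) * q ≤ p.asIdeal := by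
    rw [FractionalIdeal.mul_le]
    intro i hi y hy
    obtain ⟨x, hx, rfl⟩ := (FractionalIdeal.mem_coeIdeal A⁰).mp hi
    have hint : ∀ z ∈ p.asIdeal, ∃ t : A, algebraMap A K t = algebraMap A K z * y := fun z hz => by
      have := FractionalIdeal.mul_mem_mul (FractionalIdeal.mem_coeIdeal_of_mem A⁰ hz) hy
      rw [hq] at this
      exact (FractionalIdeal.mem_one_iff A⁰).mp this
    obtain ⟨u, hu⟩ := hint x hx
    rw [← hu]
    refine FractionalIdeal.mem_coeIdeal_of_mem A⁰ (by_contra fun hup => ?_)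
    obtain ⟨z, hz, hzu⟩ := hcon x hx u hup
    obtain ⟨t, ht⟩ := hint z hz
    refine hzu (Ideal.mem_span_singleton'.mpr ⟨t, FaithfulSMul.algebraMap_injective A K ?_⟩)
    rw [map_mul, map_mul, ht, hu]
    ring
  rw [hq, ← FractionalIdeal.coeIdeal_top, FractionalIdeal.coeIdeal_le_coeIdeal] at hle
  exact p.isMaximal.ne_top (top_le_iff.mp hle)

/-- A local generator `x` of `p` works: `A_p/xA_p` is the residue field. -/
theorem IsInvertible.exists_ordAt_eq_one [IsDomain A] [IsNoetherianRing A]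
    [Ring.KrullDimLE 1 A] (hA : ¬ IsField A) {p : MaximalSpectrum A} (hp : IsInvertible K p) :
    ∃ x : Kˣ, ordAt p x = 1 := by
  obtain ⟨x, hx, u, hu, h⟩ := hp.exists_mul_mem
  have hx0 : x ≠ 0 := by
    rintro rfl
    obtain ⟨z, hz, hz0⟩ := Submodule.exists_mem_ne_zero_of_ne_bot (maximal_ne_bot hA p)
    have := h z hz
    simp only [Ideal.mem_span_singleton, zero_dvd_iff, mul_eq_zero, hz0, or_false] at this
    exact hu (this ▸ zero_mem _)
  refine ⟨unitOfNeZero A K hx0, ?_⟩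
  have hmap : (Ideal.span {x}).map (algebraMap A (Localization.AtPrime p.asIdeal)) =
      p.asIdeal.map (algebraMap A (Localization.AtPrime p.asIdeal)) := by
    refine le_antisymm (Ideal.map_mono ((Ideal.span_singleton_le_iff_mem _).mpr hx)) ?_
    refine Ideal.map_le_iff_le_comap.mpr fun z hz => ?_
    have hu' := IsLocalization.map_units (Localization.AtPrime p.asIdeal)
      (⟨u, hu⟩ : p.asIdeal.primeCompl)
    rw [Ideal.mem_comap]
    refine (Ideal.unit_mul_mem_iff_mem _ hu').mp ?_
    rw [← map_mul]
    exact Ideal.mem_map_of_mem _ (h z hz)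
  have hlen : localLength p.asIdeal (A ⧸ Ideal.span {x}) = 1 := by
    rw [← localLength_quotient_self p.asIdeal, localLength_quotient, localLength_quotient]
    exact (Submodule.quotEquivOfEq _ _ hmap).length_eq
  rw [ordAt_unitOfNeZero, hlen]
  rfl

/-- A maximal ideal that does not contain the conductor is invertible. -/
theorem isInvertible_of_conductor [IsDomain A] {B : Type*} [CommRing B] [IsDedekindDomain B] [Algebra A B]
    [Algebra B K] [IsFractionRing B K] [IsScalarTower A B K] (hA : ¬ IsField A)
    {c : A} (hc : ∀ b : B, c • b ∈ (Algebra.linearMap A B).range)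
    {p : MaximalSpectrum A} (hcp : c ∉ p.asIdeal) : IsInvertible K p := by
  have hinj : Function.Injective (algebraMap A B) := by
    have h := FaithfulSMul.algebraMap_injective A K
    rw [IsScalarTower.algebraMap_eq A B K] at h
    exact Function.Injective.of_comp (f := algebraMap B K) (by simpa using h)
  have hp0 : (p.asIdeal : FractionalIdeal A⁰ K) ≠ 0 :=
    FractionalIdeal.coeIdeal_ne_zero.mpr (maximal_ne_bot hA p)
  -- It suffices to show `c ∈ p p⁻¹`: this integral ideal contains the maximal ideal `p`, and `c ∉
  -- p`, so it is the unit ideal.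
  let I : FractionalIdeal A⁰ K := p.asIdeal * (p.asIdeal : FractionalIdeal A⁰ K)⁻¹
  let M : FractionalIdeal B⁰ K := (p.asIdeal.map (algebraMap A B) : Ideal B)
  have hM : M ≠ 0 := FractionalIdeal.coeIdeal_ne_zero.mpr
    ((Ideal.map_eq_bot_iff_of_injective hinj).not.mpr (maximal_ne_bot hA p))
  have hone : M * M⁻¹ = 1 := mul_inv_cancel₀ hM
  -- Products of `y` with `p` lie in `B`, and `c` brings `B` into `A`.
  have hinv : ∀ y ∈ M⁻¹, algebraMap A K c * y ∈ (p.asIdeal : FractionalIdeal A⁰ K)⁻¹ := by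
    intro y hy
    rw [FractionalIdeal.mem_inv_iff hp0]
    intro z hz
    obtain ⟨z, hzp, rfl⟩ := (FractionalIdeal.mem_coeIdeal A⁰).mp hz
    have hzM : algebraMap B K (algebraMap A B z) ∈ M :=
      FractionalIdeal.mem_coeIdeal_of_mem B⁰ (Ideal.mem_map_of_mem _ hzp)
    obtain ⟨b, hb⟩ := (FractionalIdeal.mem_one_iff B⁰).mp
      ((FractionalIdeal.mem_inv_iff hM).mp hy _ hzM)
    obtain ⟨a, ha⟩ := hc b
    refine (FractionalIdeal.mem_one_iff A⁰).mpr ⟨a, ?_⟩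
    rw [Algebra.linearMap_apply] at ha
    rw [IsScalarTower.algebraMap_apply A B K, ha, Algebra.smul_def, map_mul, hb,
      ← IsScalarTower.algebraMap_apply, ← IsScalarTower.algebraMap_apply, mul_assoc]
  -- The claim is for all `y` at once, so that a coefficient from `B` in `m` can be moved into `y`.
  have hmul : ∀ m ∈ p.asIdeal.map (algebraMap A B), ∀ y ∈ M⁻¹,
      algebraMap A K c * (algebraMap B K m * y) ∈ I := by
    intro m hm
    refine Submodule.span_induction (p := fun m _ => ∀ y ∈ M⁻¹,
      algebraMap A K c * (algebraMap B K m * y) ∈ I) ?_ ?_ ?_ ?_ hm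
    · rintro _ ⟨z, hz, rfl⟩ y hy
      have := FractionalIdeal.mul_mem_mul (FractionalIdeal.mem_coeIdeal_of_mem A⁰ hz) (hinv y hy)
      rw [← IsScalarTower.algebraMap_apply]
      convert this using 1
      ring
    · intro y _
      simpa using I.zero_mem
    · intro m n _ _ hm hn y hy
      rw [map_add, add_mul, mul_add]
      exact (I : Submodule A K).add_mem (hm y hy) (hn y hy)
    · intro b m _ hm y hy
      have := hm (b • y) (Submodule.smul_mem (M⁻¹ : FractionalIdeal B⁰ K).1 b hy)
      convert this using 1
      rw [smul_eq_mul, map_mul, Algebra.smul_def]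
      ring
  have hcI : algebraMap A K c ∈ I := by
    have h1 : (1 : K) ∈ M * M⁻¹ := hone ▸ FractionalIdeal.one_mem_one B⁰
    suffices ∀ w ∈ M * M⁻¹, algebraMap A K c * w ∈ I by simpa using this 1 h1
    intro w hw
    refine FractionalIdeal.mul_induction_on hw ?_ ?_
    · intro m hm y hy
      obtain ⟨m, hm', rfl⟩ := (FractionalIdeal.mem_coeIdeal B⁰).mp hm
      exact hmul m hm' y hy
    · intro x y hx hy
      rw [mul_add]
      exact (I : Submodule A K).add_mem hx hy
  have hI1 : I ≤ 1 := FractionalIdeal.mul_one_div_le_one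
  obtain ⟨J, hJ⟩ := FractionalIdeal.le_one_iff_exists_coeIdeal.mp hI1
  have hpJ : p.asIdeal ≤ J := by
    rw [← FractionalIdeal.coeIdeal_le_coeIdeal K, hJ]
    exact FractionalIdeal.le_self_mul_inv FractionalIdeal.coeIdeal_le_one
  have hcJ : c ∈ J := by
    rw [← hJ] at hcI
    obtain ⟨d, hd, hdc⟩ := (FractionalIdeal.mem_coeIdeal A⁰).mp hcI
    exact FaithfulSMul.algebraMap_injective A K hdc ▸ hd
  have hJtop : J = ⊤ := by_contra fun h => hcp (p.isMaximal.eq_of_le h hpJ ▸ hcJ)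
  refine IsUnit.of_mul_eq_one (p.asIdeal : FractionalIdeal A⁰ K)⁻¹ (?_ : I = 1)
  rw [← hJ, hJtop, FractionalIdeal.coeIdeal_top]

theorem finite_nonInvertible (A K B : Type*) [CommRing A] [IsDomain A] [IsNoetherianRing A]
    [Ring.KrullDimLE 1 A] (hA : ¬ IsField A) [Field K] [Algebra A K] [IsFractionRing A K]
    [CommRing B] [IsDedekindDomain B] [Algebra A B] [Module.Finite A B] [Algebra B K]
    [IsFractionRing B K] [IsScalarTower A B K] : Finite (NonInvertible A K) := by
  obtain ⟨c, hc, hcB⟩ := exists_forall_smul_mem_range A B K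
  refine ((finite_maximal_mem hc).subset fun p hp => ?_).to_subtype
  by_contra hcp
  exact hp (isInvertible_of_conductor K hA hcB hcp)

end Invertible

/-! ### Local Chow groups -/

section LocalChow

variable {A : Type*} [CommRing A] (p : MaximalSpectrum A)

theorem eq_closedPoint (q : MaximalSpectrum (Localization.AtPrime p.asIdeal)) :
    q = closedPoint p :=
  MaximalSpectrum.ext (IsLocalRing.eq_maximalIdeal q.isMaximal)

theorem localLength_closedPoint (a : A) :
    localLength (closedPoint p).asIdeal (Localization.AtPrime p.asIdeal ⧸
      Ideal.span {algebraMap A (Localization.AtPrime p.asIdeal) a}) =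
    localLength p.asIdeal (A ⧸ Ideal.span {a}) := by
  rw [localLength_quotient_span_singleton p.asIdeal]
  exact localLength_maximalIdeal

variable [IsDomain A]

theorem algebraMap_atPrime_ne_zero {a : A} (ha : a ≠ 0) :
    algebraMap A (Localization.AtPrime p.asIdeal) a ≠ 0 :=
  nonZeroDivisors.ne_zero (algebraMap_atPrime_mem p.asIdeal (mem_nonZeroDivisors_of_ne_zero ha))

/-- The values of the order homomorphism, without reference to the field of fractions. -/
theorem exists_ordAt_eq_iff_localLength {R : Type*} [CommRing R] [IsDomain R] [IsNoetherianRing R]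
    [Ring.KrullDimLE 1 R] (K : Type*) [Field K] [Algebra R K] [IsFractionRing R K]
    (q : MaximalSpectrum R) (n : ℤ) :
    (∃ x : Kˣ, ordAt q x = n) ↔ ∃ a b : R, a ≠ 0 ∧ b ≠ 0 ∧
      ((localLength q.asIdeal (R ⧸ Ideal.span {a})).toNat : ℤ) -
        ((localLength q.asIdeal (R ⧸ Ideal.span {b})).toNat : ℤ) = n := by
  refine ⟨?_, ?_⟩
  · rintro ⟨x, rfl⟩
    obtain ⟨a, b, ha, hb, hx⟩ := exists_algebraMap_div_algebraMap R x
    exact ⟨a, b, ha, hb, (ordAt_eq_localLength_sub q x a b ha hb hx).symm⟩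
  · rintro ⟨a, b, ha, hb, rfl⟩
    exact ⟨unitOfNeZero R K ha / unitOfNeZero R K hb, ordAt_eq_localLength_sub q _ a b ha hb
      (Units.val_div_eq_div_val _ _)⟩

/-- A nonzero element of `A_p` generates the same ideal as a nonzero element of `A`. -/
theorem exists_span_algebraMap_eq {a : Localization.AtPrime p.asIdeal} (ha : a ≠ 0) :
    ∃ c : A, c ≠ 0 ∧
      Ideal.span {algebraMap A (Localization.AtPrime p.asIdeal) c} = Ideal.span {a} := by
  obtain ⟨⟨c, s⟩, hc⟩ := IsLocalization.surj p.asIdeal.primeCompl a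
  have hs := IsLocalization.map_units (Localization.AtPrime p.asIdeal) s
  refine ⟨c, ?_, ?_⟩
  · rintro rfl
    rw [map_zero] at hc
    exact mul_ne_zero ha hs.ne_zero hc
  · rw [← hc, Ideal.span_singleton_mul_right_unit hs]

/-- With only one maximal ideal, a principal divisor is just the order of a function there. -/
theorem FracChow.mk_single_eq_zero_iff {R : Type*} [CommRing R] [IsDomain R] [IsNoetherianRing R]
    [Ring.KrullDimLE 1 R] {q : MaximalSpectrum R} (hq : ∀ q', q' = q) (n : ℤ) :
    FracChow.mk R (Finsupp.single q n) = 0 ↔ ∃ x : (FractionRing R)ˣ, ordAt q x = n := by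
  refine (QuotientAddGroup.eq_zero_iff _).trans ⟨?_, ?_⟩
  · rintro ⟨y, hy⟩
    refine ⟨y.toMul, ?_⟩
    rw [← divHom_apply, hy]
    simp
  · rintro ⟨y, rfl⟩
    refine ⟨Additive.ofMul y, Finsupp.ext fun q' => ?_⟩
    rw [hq q']
    simp

variable [IsNoetherianRing A] [Ring.KrullDimLE 1 A]

/-- The class of `n` times the closed point. -/
def LocalChow.ofInt : ℤ →+ LocalChow p :=
  (LocalChow.mk p).comp (Finsupp.singleAddHom (closedPoint p))

theorem LocalChow.ofInt_surjective : Function.Surjective (LocalChow.ofInt p) := by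
  intro y
  obtain ⟨D, rfl⟩ := QuotientAddGroup.mk'_surjective _ y
  refine ⟨D (closedPoint p), congrArg (LocalChow.mk p) (Finsupp.ext fun q => ?_)⟩
  rw [eq_closedPoint p q]
  simp

variable (B K : Type*) [CommRing B] [Algebra A B] [Module.Finite A B] [IsDedekindDomain B]
  [Field K] [Algebra A K] [IsFractionRing A K] [Algebra B K] [IsFractionRing B K]
  [IsScalarTower A B K]

-- The local Chow group is formed with `FractionRing A_p`, whereas the gcd describes orders on `K`.
-- Expressing both value sets by lengths avoids identifying the two fields.
include K in
theorem LocalChow.ofInt_eq_zero_iff (hA : ¬ IsField A) (n : ℤ) :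
    LocalChow.ofInt p n = 0 ↔ (residueDegreeGCD A B p.asIdeal : ℤ) ∣ n := by
  rw [← exists_ordAt_eq_iff K hA, exists_ordAt_eq_iff_localLength]
  refine (FracChow.mk_single_eq_zero_iff (eq_closedPoint p) n).trans ?_
  rw [exists_ordAt_eq_iff_localLength]
  refine ⟨?_, ?_⟩
  · rintro ⟨a, b, ha, hb, h⟩
    obtain ⟨c, hc, hca⟩ := exists_span_algebraMap_eq p ha
    obtain ⟨d, hd, hdb⟩ := exists_span_algebraMap_eq p hb
    refine ⟨c, d, hc, hd, ?_⟩
    rwa [← localLength_closedPoint p, ← localLength_closedPoint p, hca, hdb]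
  · rintro ⟨a, b, ha, hb, h⟩
    refine ⟨_, _, algebraMap_atPrime_ne_zero p ha, algebraMap_atPrime_ne_zero p hb, ?_⟩
    rwa [localLength_closedPoint, localLength_closedPoint]

/-- The local Chow group is cyclic of order the gcd of the residue degrees. -/
def LocalChow.equivZMod (hA : ¬ IsField A) :
    LocalChow p ≃+ ZMod (residueDegreeGCD A B p.asIdeal) :=
  (QuotientAddGroup.quotientKerEquivOfSurjective _ (LocalChow.ofInt_surjective p)).symm.trans <|
    (QuotientAddGroup.quotientAddEquivOfEq (by
      ext n
      rw [AddMonoidHom.mem_ker, LocalChow.ofInt_eq_zero_iff p B K hA,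
        Int.mem_zmultiples_iff])).trans
      (Int.quotientZMultiplesNatEquivZMod (residueDegreeGCD A B p.asIdeal))

theorem IsInvertible.residueDegreeGCD_eq_one (hA : ¬ IsField A) {p : MaximalSpectrum A}
    (hp : IsInvertible K p) : residueDegreeGCD A B p.asIdeal = 1 := by
  have := (exists_ordAt_eq_iff (B := B) K hA p 1).mp (hp.exists_ordAt_eq_one K hA)
  exact Nat.dvd_one.mp (Int.natCast_dvd_natCast.mp (by simpa using this))

include B in
theorem IsInvertible.subsingleton_localChow (hA : ¬ IsField A) {p : MaximalSpectrum A}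
    (hp : IsInvertible K p) : Subsingleton (LocalChow p) := by
  have e := LocalChow.equivZMod p B K hA
  rw [hp.residueDegreeGCD_eq_one B K hA] at e
  exact e.toEquiv.subsingleton

/-! ### The projection to the local Chow groups -/

variable (A) in
/-- The family of local classes of a divisor at the non-invertible maximal ideals. -/
def localClasses [Finite (NonInvertible A K)] :
    Divisor A →+ ⨁ p : NonInvertible A K, LocalChow p.1 :=
  letI := Fintype.ofFinite (NonInvertible A K)
  (DirectSum.linearEquivFunOnFintype ℤ (NonInvertible A K)
    fun p => LocalChow p.1).symm.toAddEquiv.toAddMonoidHom.comp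
    (AddMonoidHom.pi fun p => (LocalChow.ofInt p.1).comp (Finsupp.applyAddHom p.1))

omit [IsFractionRing A K] in
theorem localClasses_apply [Finite (NonInvertible A K)] (D : Divisor A) (p : NonInvertible A K) :
    localClasses A K D p = LocalChow.ofInt p.1 (D p.1) := by
  let := Fintype.ofFinite (NonInvertible A K)
  exact congrFun ((DirectSum.linearEquivFunOnFintype ℤ (NonInvertible A K)
    fun p => LocalChow p.1).apply_symm_apply (AddMonoidHom.pi (fun p : NonInvertible A K =>
      (LocalChow.ofInt p.1).comp (Finsupp.applyAddHom p.1)) D)) p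

end LocalChow

/-! ### Divisors of principal fractional ideals -/

section Dedekind

variable {S : Type*} [CommRing S] [IsDedekindDomain S]
variable (K : Type*) [Field K] [Algebra S K] [IsFractionRing S K]

variable {K} in
@[simp]
theorem divIdeal_apply (I : Additive (FractionalIdeal S⁰ K)ˣ) (P : MaximalSpectrum S) :
    divIdeal S K I P = exponent I.toMul P := rfl

theorem localLength_quotient_pow (P : MaximalSpectrum S) (hP : P.asIdeal ≠ ⊥) (n : ℕ) :
    localLength P.asIdeal (S ⧸ P.asIdeal ^ n) = n := by
  have : IsDiscreteValuationRing (Localization.AtPrime P.asIdeal) :=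
    IsLocalization.AtPrime.isDiscreteValuationRing_of_dedekind_domain S hP _
  rw [localLength_quotient, ← IsDiscreteValuationRing.length_quotient_pow_maximalIdeal
    (Localization.AtPrime P.asIdeal) n]
  exact (Submodule.quotEquivOfEq _ _
    (by rw [Ideal.map_pow, Localization.AtPrime.map_eq_maximalIdeal])).length_eq

/-- Write `I = PⁿJ` with `P ∤ J`; the factor `J` is invisible at `P`, and both sides equal `n`. -/
theorem localLength_quotient_eq_count (P : MaximalSpectrum S) (hP : P.asIdeal ≠ ⊥) {I : Ideal S}
    (hI : I ≠ ⊥) :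
    ((localLength P.asIdeal (S ⧸ I)).toNat : ℤ) =
      FractionalIdeal.count K ⟨P.asIdeal, P.isMaximal.isPrime, hP⟩ (I : FractionalIdeal S⁰ K) := by
  classical
  let v : IsDedekindDomain.HeightOneSpectrum S := ⟨P.asIdeal, P.isMaximal.isPrime, hP⟩
  change _ = FractionalIdeal.count K v I
  obtain ⟨J, hIJ, hJ⟩ := (FiniteMultiplicity.of_prime_left v.prime hI).exists_eq_pow_mul_and_not_dvd
  have hJP : ¬ J ≤ P.asIdeal := fun h => hJ (Ideal.dvd_iff_le.mpr h)
  have hJ0 : J ≠ 0 := fun h => hJ (h ▸ dvd_zero _)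
  have hcount : FractionalIdeal.count K v (J : FractionalIdeal S⁰ K) = 0 := by
    rw [FractionalIdeal.count_coe K v hJ0, Nat.cast_eq_zero]
    by_contra h
    exact hJ ((Associates.count_ne_zero_iff_dvd hJ0 v.irreducible).mp h)
  generalize multiplicity v.asIdeal I = n at hIJ
  subst hIJ
  rw [localLength_quotient_mul_of_not_le _ _ hJP, localLength_quotient_pow P hP,
    FractionalIdeal.coeIdeal_mul, FractionalIdeal.count_mul K v, hcount,
    FractionalIdeal.coeIdeal_pow, FractionalIdeal.count_pow_self]
  · simp
  · exact FractionalIdeal.coeIdeal_ne_zero.mpr (pow_ne_zero _ hP)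
  · exact FractionalIdeal.coeIdeal_ne_zero.mpr hJ0

theorem divIdeal_toPrincipalIdeal (hS : ¬ IsField S) (x : Kˣ) :
    divIdeal S K (Additive.ofMul (toPrincipalIdeal S K x)) = divHom S K (Additive.ofMul x) := by
  ext P
  have hP := maximal_ne_bot hS P
  let v : IsDedekindDomain.HeightOneSpectrum S := ⟨P.asIdeal, P.isMaximal.isPrime, hP⟩
  obtain ⟨a, b, ha, hb, hx⟩ := exists_algebraMap_div_algebraMap S x
  have hspan : ∀ {c : S}, c ≠ 0 → (Ideal.span {c} : Ideal S) ≠ ⊥ := fun h => by simpa using h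
  have hcount : ∀ c : S, FractionalIdeal.count K v (Ideal.span {c} : Ideal S) =
      FractionalIdeal.count K v (FractionalIdeal.spanSingleton S⁰ (algebraMap S K c)) := fun c => by
    rw [FractionalIdeal.coeIdeal_span_singleton]
  have hsplit : FractionalIdeal.spanSingleton S⁰ (algebraMap S K a) =
      FractionalIdeal.spanSingleton S⁰ (x : K) *
        FractionalIdeal.spanSingleton S⁰ (algebraMap S K b) := by
    rw [FractionalIdeal.spanSingleton_mul_spanSingleton, hx,
      div_mul_cancel₀ _ (by simpa using hb)]
  have hadd := FractionalIdeal.count_mul K v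
    (FractionalIdeal.spanSingleton_ne_zero_iff.mpr x.ne_zero)
    (FractionalIdeal.spanSingleton_ne_zero_iff.mpr
      (by simpa using hb : algebraMap S K b ≠ 0))
  rw [← hsplit, ← hcount, ← hcount] at hadd
  rw [divHom_apply, divIdeal_apply, exponent, dif_neg hP, toMul_ofMul, toMul_ofMul,
    ordAt_eq_localLength_sub P _ a b ha hb hx,
    localLength_quotient_eq_count K P hP (hspan ha), localLength_quotient_eq_count K P hP (hspan hb)]
  change _ = FractionalIdeal.count K v _ - FractionalIdeal.count K v _
  rw [hadd, coe_toPrincipalIdeal]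
  ring

/-- Fields must be excluded: there the only maximal ideal is zero and its exponent is `0` by
convention, while the divisor group is `ℤ`. -/
theorem divIdeal_surjective (hS : ¬ IsField S) : Function.Surjective (divIdeal S K) := by
  classical
  have key : ∀ P : MaximalSpectrum S, Finsupp.single P 1 ∈ (divIdeal S K).range := fun P => by
    have hP : (P.asIdeal : FractionalIdeal S⁰ K) ≠ 0 :=
      FractionalIdeal.coeIdeal_ne_zero.mpr (maximal_ne_bot hS P)
    refine ⟨Additive.ofMul (Units.mk0 _ hP), ?_⟩
    ext Q
    have hQ := maximal_ne_bot hS Q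
    rw [divIdeal_apply, exponent, dif_neg hQ]
    have := FractionalIdeal.count_maximal K ⟨Q.asIdeal, Q.isMaximal.isPrime, hQ⟩
      ⟨P.asIdeal, P.isMaximal.isPrime, maximal_ne_bot hS P⟩
    refine this.trans ?_
    simp [Finsupp.single_apply, IsDedekindDomain.HeightOneSpectrum.ext_iff, MaximalSpectrum.ext_iff]
  intro D
  change D ∈ (divIdeal S K).range
  rw [← Finsupp.sum_single D]
  refine AddSubgroup.sum_mem _ fun P _ => ?_
  simpa using AddSubgroup.zsmul_mem _ (key P) (D P)

theorem idealClass_surjective : Function.Surjective (idealClass S K) := fun x =>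
  ClassGroup.induction K (P := fun y => ∃ I, idealClass S K I = Additive.ofMul y)
    (fun I => ⟨Additive.ofMul I, rfl⟩) x.toMul

variable {K} in
theorem idealClass_eq_zero_iff (I : Additive (FractionalIdeal S⁰ K)ˣ) :
    idealClass S K I = 0 ↔ ∃ x : Kˣ, Additive.ofMul (toPrincipalIdeal S K x) = I := by
  change ClassGroup.mk K I.toMul = 1 ↔ _
  rw [← (ClassGroup.equiv K).map_eq_one_iff, ClassGroup.equiv_mk, QuotientGroup.mk'_apply,
    QuotientGroup.eq_one_iff, FractionalIdeal.canonicalEquiv_self]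
  rfl

end Dedekind

/-! ### The exact sequence -/

section ExactSequence

variable (A B K : Type*) [CommRing A] [IsDomain A] [IsNoetherianRing A] [Ring.KrullDimLE 1 A]
  [CommRing B] [IsDedekindDomain B] [Algebra A B] [Module.Finite A B]
  [Field K] [Algebra A K] [IsFractionRing A K] [Algebra B K] [IsFractionRing B K]
  [IsScalarTower A B K]

/-- The homomorphism of Chow groups induced by the push-forward of divisors. -/
def Chow.pushforward : Chow B K →+ Chow A K :=
  QuotientAddGroup.map _ _ (ChowDomain.pushforward A B) <| by
    rintro _ ⟨x, rfl⟩
    exact ⟨x, (pushforward_divHom K x).symm⟩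

theorem Chow.pushforward_mk (D : Divisor B) :
    Chow.pushforward A B K (Chow.mk B K D) = Chow.mk A K (ChowDomain.pushforward A B D) := rfl

variable [Finite (NonInvertible A K)]

include B in
theorem localClasses_divHom (hA : ¬ IsField A) (x : Additive Kˣ) :
    localClasses A K (divHom A K x) = 0 := by
  refine DFinsupp.ext fun p => ?_
  refine (localClasses_apply K (divHom A K x) p).trans ?_
  exact (LocalChow.ofInt_eq_zero_iff p.1 B K hA _).mpr
    ((exists_ordAt_eq_iff K hA p.1 _).mp ⟨x.toMul, rfl⟩)

/-- The canonical projection of the Chow group to the local Chow groups at the non-invertible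
maximal ideals. -/
def Chow.toLocal (hA : ¬ IsField A) : Chow A K →+ ⨁ p : NonInvertible A K, LocalChow p.1 :=
  QuotientAddGroup.lift _ (localClasses A K) <| by
    rintro _ ⟨x, rfl⟩
    exact localClasses_divHom A B K hA x

theorem Chow.toLocal_mk_apply (hA : ¬ IsField A) (D : Divisor A) (p : NonInvertible A K) :
    Chow.toLocal A B K hA (Chow.mk A K D) p = LocalChow.ofInt p.1 (D p.1) :=
  localClasses_apply K D p

/-- The divisibility criterion for push-forwards is vacuous at invertible `p`, where the gcd is 1;
elsewhere it is the vanishing of the local class. -/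
theorem Chow.toLocal_mk_eq_zero_iff (hA : ¬ IsField A) (D : Divisor A) :
    Chow.toLocal A B K hA (Chow.mk A K D) = 0 ↔ D ∈ (ChowDomain.pushforward A B).range := by
  rw [mem_range_pushforward_iff]
  refine ⟨fun h p => ?_, fun h => DFinsupp.ext fun p => ?_⟩
  · by_cases hp : IsInvertible K p
    · rw [hp.residueDegreeGCD_eq_one B K hA]
      simp
    · rw [← LocalChow.ofInt_eq_zero_iff p B K hA,
        ← Chow.toLocal_mk_apply A B K hA D ⟨p, hp⟩, h]
      rfl
  · refine (Chow.toLocal_mk_apply A B K hA D p).trans ?_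
    exact (LocalChow.ofInt_eq_zero_iff p.1 B K hA _).mpr (h p.1)

theorem Chow.toLocal_eq_zero_iff (hA : ¬ IsField A) (y : Chow A K) :
    Chow.toLocal A B K hA y = 0 ↔ y ∈ (Chow.pushforward A B K).range := by
  obtain ⟨D, rfl⟩ := QuotientAddGroup.mk'_surjective _ y
  refine ⟨fun h => ?_, ?_⟩
  · obtain ⟨E, rfl⟩ := (Chow.toLocal_mk_eq_zero_iff A B K hA D).mp h
    exact ⟨Chow.mk B K E, rfl⟩
  · rintro ⟨z, hz⟩
    obtain ⟨E, rfl⟩ := QuotientAddGroup.mk'_surjective _ z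
    rw [← hz]
    exact (Chow.toLocal_mk_eq_zero_iff A B K hA _).mpr ⟨E, rfl⟩

theorem Chow.toLocal_surjective (hA : ¬ IsField A) :
    Function.Surjective (Chow.toLocal A B K hA) := by
  classical
  intro z
  have := Fintype.ofFinite (NonInvertible A K)
  choose n hn using fun p : NonInvertible A K => LocalChow.ofInt_surjective p.1 (z p)
  refine ⟨Chow.mk A K (∑ p : NonInvertible A K, Finsupp.single p.1 (n p)),
    DFinsupp.ext fun q => (Chow.toLocal_mk_apply A B K hA _ q).trans ?_⟩
  rw [← hn q, Finsupp.finsetSum_apply]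
  simp [Finsupp.single_apply, ← Subtype.ext_iff]

end ExactSequence

/-! ### The class group of the normalization -/

section ClassGroup

variable (A K : Type*) [CommRing A] [IsDomain A] [IsNoetherianRing A] [Ring.KrullDimLE 1 A]
  [Field K] [Algebra A K] [IsFractionRing A K] [Module.Finite A (integralClosure A K)]

/-- The class in the Chow group of `A` of the push-forward of the divisor of a fractional ideal. -/
def idealToChow :
    Additive (FractionalIdeal (integralClosure A K)⁰ K)ˣ →+ Chow A K :=
  ((Chow.pushforward A (integralClosure A K) K).comp (Chow.mk (integralClosure A K) K)).comp
    (divIdeal (integralClosure A K) K)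

theorem range_idealToChow (hS : ¬ IsField (integralClosure A K)) :
    (idealToChow A K).range = (Chow.pushforward A (integralClosure A K) K).range := by
  refine le_antisymm ?_ ?_
  · rintro _ ⟨I, rfl⟩
    exact ⟨Chow.mk _ K (divIdeal _ K I), rfl⟩
  · rintro _ ⟨z, rfl⟩
    obtain ⟨D, rfl⟩ := QuotientAddGroup.mk'_surjective _ z
    obtain ⟨I, rfl⟩ := divIdeal_surjective K hS D
    exact ⟨I, rfl⟩

/-- Dividing `I` by the principal ideal of `x` keeps its class and subtracts `div_A(x)` from its
push-forward. This trades a principal push-forward for a zero one. -/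
theorem idealToChow_eq_zero_iff (hS : ¬ IsField (integralClosure A K))
    (I : Additive (FractionalIdeal (integralClosure A K)⁰ K)ˣ) :
    idealToChow A K I = 0 ↔ idealClass (integralClosure A K) K I ∈ relations A K := by
  have hprin : ∀ x : Kˣ, pushforward A (integralClosure A K) (divIdeal (integralClosure A K) K
      (Additive.ofMul (toPrincipalIdeal (integralClosure A K) K x))) =
        divHom A K (Additive.ofMul x) := fun x => by
    rw [divIdeal_toPrincipalIdeal K hS, pushforward_divHom]
  refine (QuotientAddGroup.eq_zero_iff _).trans ⟨?_, ?_⟩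
  · rintro ⟨x, hx⟩
    refine ⟨I - Additive.ofMul (toPrincipalIdeal (integralClosure A K) K x.toMul), ?_, ?_⟩
    · change pushforward A _ (divIdeal _ K _) = 0
      rw [map_sub, map_sub, hprin, sub_eq_zero]
      exact hx.symm
    · rw [map_sub, sub_eq_self]
      exact (idealClass_eq_zero_iff _).mpr ⟨_, rfl⟩
  · rintro ⟨J, hJ, hJI⟩
    rw [eq_comm, ← sub_eq_zero, ← map_sub] at hJI
    obtain ⟨x, hx⟩ := (idealClass_eq_zero_iff _).mp hJI
    refine ⟨Additive.ofMul x, ?_⟩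
    have hJ' : pushforward A (integralClosure A K) (divIdeal (integralClosure A K) K J) = 0 := hJ
    rw [← hprin, hx, map_sub, map_sub, hJ', sub_zero]

/-- The isomorphism of the class group of the normalization modulo relations with the image of the
push-forward. -/
def classGroupEquiv (hS : ¬ IsField (integralClosure A K)) :
    (Additive (ClassGroup (integralClosure A K)) ⧸ relations A K) ≃+
      (Chow.pushforward A (integralClosure A K) K).range :=
  have hsurj : Function.Surjective ((QuotientAddGroup.mk' (relations A K)).comp
      (idealClass (integralClosure A K) K)) :=
    (QuotientAddGroup.mk'_surjective _).comp (idealClass_surjective K)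
  -- Both groups are quotients of the group of fractional ideals, so it suffices to compare the two
  -- kernels.
  have hker : ((QuotientAddGroup.mk' (relations A K)).comp
      (idealClass (integralClosure A K) K)).ker = (idealToChow A K).ker := by
    ext I
    rw [AddMonoidHom.mem_ker, AddMonoidHom.mem_ker, idealToChow_eq_zero_iff A K hS]
    exact QuotientAddGroup.eq_zero_iff _
  ((QuotientAddGroup.quotientKerEquivOfSurjective _ hsurj).symm.trans
    ((QuotientAddGroup.quotientAddEquivOfEq hker).trans
      (QuotientAddGroup.quotientKerEquivRange (idealToChow A K)))).trans
    (AddEquiv.addSubgroupCongr (range_idealToChow A K hS))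

theorem classGroupEquiv_mk (hS : ¬ IsField (integralClosure A K))
    (I : Additive (FractionalIdeal (integralClosure A K)⁰ K)ˣ) :
    (classGroupEquiv A K hS (QuotientAddGroup.mk' (relations A K)
      (idealClass (integralClosure A K) K I)) : Chow A K) = idealToChow A K I := by
  have h : ∀ hsurj, (QuotientAddGroup.quotientKerEquivOfSurjective
      ((QuotientAddGroup.mk' (relations A K)).comp (idealClass (integralClosure A K) K))
        hsurj).symm (QuotientAddGroup.mk' (relations A K)
          (idealClass (integralClosure A K) K I)) = QuotientAddGroup.mk I := fun hsurj => by
    rw [AddEquiv.symm_apply_eq]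
    rfl
  simp only [classGroupEquiv, AddEquiv.trans_apply, h]
  rfl

end ClassGroup

end ChowDomain

end

open ChowDomain in
theorem theorem2p8 (O : Type*) [CommRing O] [IsDomain O] [IsNoetherianRing O]
    [Ring.KrullDimLE 1 O] (hO : ¬ IsField O)
    (K : Type*) [Field K] [Algebra O K] [IsFractionRing O K]
    [Module.Finite O (integralClosure O K)] :
    -- the local Chow group at an invertible maximal ideal is trivial
    (∀ p : MaximalSpectrum O, IsInvertible K p → Subsingleton (LocalChow p)) ∧
    -- the local Chow groups at the finitely many non-invertible maximal ideals
    Finite (NonInvertible O K) ∧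
    (∀ p : NonInvertible O K,
      Nonempty (LocalChow p.1 ≃+ ZMod (residueDegreeGCD O (integralClosure O K) p.1.asIdeal))) ∧
    -- the homomorphism induced by the push-forward, and the canonical projection
    ∃ (fbar : Chow (integralClosure O K) K →+ Chow O K)
      (pr : Chow O K →+ ⨁ p : NonInvertible O K, LocalChow p.1),
      (∀ D : Divisor (integralClosure O K),
        fbar (Chow.mk (integralClosure O K) K D) =
          Chow.mk O K (pushforward O (integralClosure O K) D)) ∧
      (∀ (D : Divisor O) (p : NonInvertible O K),
        pr (Chow.mk O K D) p =
          LocalChow.mk p.1 (Finsupp.single (closedPoint p.1) (D p.1))) ∧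
      -- the exact sequence
      Function.Injective fbar.range.subtype ∧
      Function.Exact fbar.range.subtype pr ∧
      Function.Surjective pr ∧
      -- the outer terms
      (∃ e : (Additive (ClassGroup (integralClosure O K)) ⧸ relations O K) ≃+ fbar.range,
        ∀ I : Additive (FractionalIdeal (nonZeroDivisors (integralClosure O K)) K)ˣ,
          (e (QuotientAddGroup.mk' (relations O K) (idealClass (integralClosure O K) K I)) :
              Chow O K) =
            fbar (Chow.mk (integralClosure O K) K (divIdeal (integralClosure O K) K I))) ∧
      Nonempty ((⨁ p : NonInvertible O K, LocalChow p.1) ≃+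
        ⨁ p : NonInvertible O K,
          ZMod (residueDegreeGCD O (integralClosure O K) p.1.asIdeal)) := by
  have hfin := finite_nonInvertible O K (integralClosure O K) hO
  have hS : ¬ IsField (integralClosure O K) := fun h =>
    hO (isField_of_isIntegral_of_isField (FaithfulSMul.algebraMap_injective O _) h)
  refine ⟨fun p hp => hp.subsingleton_localChow (integralClosure O K) K hO, hfin,
    fun p => ⟨LocalChow.equivZMod p.1 (integralClosure O K) K hO⟩,
    Chow.pushforward O (integralClosure O K) K, Chow.toLocal O (integralClosure O K) K hO,
    Chow.pushforward_mk O (integralClosure O K) K,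
    Chow.toLocal_mk_apply O (integralClosure O K) K hO,
    AddSubgroup.subtype_injective _, fun y => ?_, Chow.toLocal_surjective O _ K hO,
    ⟨classGroupEquiv O K hS, classGroupEquiv_mk O K hS⟩,
    ⟨DFinsupp.mapRange.addEquiv fun p => LocalChow.equivZMod p.1 (integralClosure O K) K hO⟩⟩
  rw [Chow.toLocal_eq_zero_iff]
  exact ⟨fun h => ⟨⟨y, h⟩, rfl⟩, by rintro ⟨z, rfl⟩; exact z.2⟩
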